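/- All graphs are finite and simple. Let $G$ be a graph and let $f$ assign a positive integer $f(v)$ to each vertex $v\in V(G)$. An $f$-coloring of $G$ is a coloring of the edges of $G$ in which, at each vertex $v$, each color appears on at most $f(v)$ of the edges incident with $v$. The minimum number of colors in an $f$-coloring of $G$ is denoted by $\chi'_f(G)$. Put $\Delta_f(G)=\max_{v\in V(G)}\lceil d_G(v)/f(v)\rceil$. The graph $G$ is $f$-Class $1$ if $\chi'_f(G)=\Delta_f(G)$. The $f$-core $G_{\Delta_f}$ is the subgraph of $G$ induced on the vertices $v$ with $d_G(v)=f(v)\,\Delta_f(G)$. A graph is unicyclic if it is connected and contains exactly one cycle. **Theorem.** Let $G$ be a connected graph and let $f:V(G)\to\{1,2,3,\dots\}$. If every connected component of $G_{\Delta_f}$ is a tree or a unicyclic graph, and $G_{\Delta_f}$ is not $2$-regular (an empty $f$-core, which has no vertices, is not regarded as $2$-regular), then $G$ is $f$-Class $1$. -/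

import Mathlib

namespace FColoring

/-- `Δ_f(G)`, the maximum over the vertices `v` of `⌈d(v) / f(v)⌉`. -/
def fMaxDegree {V : Type*} [Fintype V] (G : SimpleGraph V) [DecidableRel G.Adj]
    (f : V → ℕ) : ℕ :=
  Finset.univ.sup fun v => ⌈(G.degree v : ℚ) / (f v : ℚ)⌉₊

/-- An edge colouring `c` is an `f`-colouring if each colour appears on at most `f v` of the
edges at each vertex `v`. -/
def IsFColoring {V : Type*} (G : SimpleGraph V) (f : V → ℕ) {C : Type*}
    (c : G.edgeSet → C) : Prop :=
  ∀ (v : V) (i : C), Nat.card {e : G.edgeSet // v ∈ (e : Sym2 V) ∧ c e = i} ≤ f v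

/-- `G` can be `f`-coloured with `k` colours. -/
def FColorable {V : Type*} (G : SimpleGraph V) (f : V → ℕ) (k : ℕ) : Prop :=
  ∃ c : G.edgeSet → Fin k, IsFColoring G f c

/-- `χ'_f(G)`, the minimum number of colours in an `f`-colouring of `G`. -/
noncomputable def fChromaticIndex {V : Type*} (G : SimpleGraph V) (f : V → ℕ) : ℕ :=
  sInf {k : ℕ | FColorable G f k}

/-- For positive `f` the minimum defining `χ'_f(G)` is over a nonempty set, and is attained. -/
theorem fColorable_fChromaticIndex {V : Type*} [Finite V] (G : SimpleGraph V) (f : V → ℕ)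
    (hf : ∀ v, 0 < f v) : FColorable G f (fChromaticIndex G f) := by
  refine Nat.sInf_mem (s := {k : ℕ | FColorable G f k}) ⟨Nat.card G.edgeSet, ?_⟩
  refine ⟨Finite.equivFin G.edgeSet, fun v i => le_trans ?_ (hf v)⟩
  have : Subsingleton {e : G.edgeSet // v ∈ (e : Sym2 V) ∧ Finite.equivFin G.edgeSet e = i} :=
    ⟨fun a b => Subtype.ext ((Finite.equivFin G.edgeSet).injective
      (a.2.2.trans b.2.2.symm))⟩
  exact Finite.card_le_one_iff_subsingleton.mpr this

/-- `G` is `f`-Class 1 if `χ'_f(G) = Δ_f(G)`. -/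
def IsFClassOne {V : Type*} [Fintype V] (G : SimpleGraph V) [DecidableRel G.Adj]
    (f : V → ℕ) : Prop :=
  fChromaticIndex G f = fMaxDegree G f

/-- The set of `f`-maximum vertices, those with `d(v) = f(v) Δ_f(G)`. -/
abbrev fMaxVertices {V : Type*} [Fintype V] (G : SimpleGraph V) [DecidableRel G.Adj]
    (f : V → ℕ) : Set V :=
  {v : V | G.degree v = f v * fMaxDegree G f}

/-- The `f`-core `G_{Δ_f}`, the subgraph induced on the `f`-maximum vertices. -/
abbrev fCore {V : Type*} [Fintype V] (G : SimpleGraph V) [DecidableRel G.Adj]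
    (f : V → ℕ) : SimpleGraph (fMaxVertices G f) :=
  G.induce (fMaxVertices G f)

/-- A graph is unicyclic if it is connected and exactly one of its subgraphs is a cycle (a cycle
subgraph being the set of vertices and edges traversed by a closed walk that is a cycle). -/
def IsUnicyclic {V : Type*} (G : SimpleGraph V) : Prop :=
  G.Connected ∧ ∃! H : G.Subgraph, ∃ (v : V) (p : G.Walk v v), p.IsCycle ∧ p.toSubgraph = H

end FColoring

/-! Put k = Δ_f(G), always a lower bound for the number of colours. If k colours do not suffice,
take an inclusion-minimal edge set E that is not k-colourable, and let M be the set of vertices with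
d_E = k f, all of which lie in the f-core. By a Vizing-type `adjacency_lemma`, for each edge xw of E
the vertex x has, along E, at least k f(w) - d_E(w) + 1 neighbours in M other than w. Hence every
vertex touched by E has two neighbours in M, and M induces minimum degree at least 2 in the core.
Components with at most one cycle leave no room for more (`card_neighbors_le_two`), so these degrees
are exactly 2; fed back into the adjacency lemma, this gives d_E(w) ≥ k f(w) - 1 at every touched w.

If E is all of E(G), then M is the whole core, which is 2-regular and so excluded. Otherwise, by
connectivity, some touched v has an edge of G outside E; then d_G(v) = k f(v), so v is in the core
but not in M. Adding v to M keeps the minimum degree at least 2 but gives a neighbour of v in M a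
third neighbour, a contradiction.

The adjacency lemma combines fans with `exists_kempe_exchange`. Since a colour may repeat at a
vertex, Kempe chains are obtained by pairing off, at each vertex, as many a-edges with b-edges as
possible; the resulting components are paths or cycles, with at most two unpaired ends. -/

namespace FColoring

open Finset

/-! ### Pairings of edges and their components -/

/-- If an involution `τ` preserving `p` maps `T` into `S`, then at most as many elements of `T` as
of `S` satisfy `p`. -/
theorem card_filter_le_of_involutive {α : Type*} {S T : Finset α} {τ : α → α}
    (hτ : Function.Involutive τ) (hTS : ∀ e ∈ T, τ e ∈ S) (p : α → Prop) [DecidablePred p]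
    (hp : ∀ e, p (τ e) ↔ p e) : #{e ∈ T | p e} ≤ #{e ∈ S | p e} := by
  refine card_le_card_of_injOn τ (fun e he => ?_) hτ.injective.injOn
  simp only [coe_filter, Set.mem_ofPred_eq] at he ⊢
  exact ⟨hTS e he.1, (hp e).2 he.2⟩

/-- The fixed point `e₀` lies outside `T`, so `τ` never sends an element of `T` to it: one element
of `S` is left over. -/
theorem card_filter_lt_of_involutive {α : Type*} {S T : Finset α} {τ : α → α}
    (hτ : Function.Involutive τ) (hTS : ∀ e ∈ T, τ e ∈ S) (p : α → Prop) [DecidablePred p]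
    (hp : ∀ e, p (τ e) ↔ p e) {e₀ : α} (h₀ : e₀ ∈ S) (h₀T : e₀ ∉ T) (hfix : τ e₀ = e₀)
    (hp₀ : p e₀) : #{e ∈ T | p e} < #{e ∈ S | p e} := by
  classical
  have h := card_filter_le_of_involutive (S := S.erase e₀) hτ (fun e he => by
    refine mem_erase.2 ⟨fun h => h₀T ?_, hTS e he⟩
    have : e = e₀ := by rw [← hτ e, h, hfix]
    exact this ▸ he) p hp
  refine h.trans_lt (card_lt_card ?_)
  rw [ssubset_iff_of_subset (filter_subset_filter _ (erase_subset _ _))]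
  exact ⟨e₀, by simp [h₀, hp₀], by simp⟩

/-- Two disjoint finite sets can be paired up as far as possible by an involution, with a
prescribed set `U` of unpaired elements. -/
theorem exists_involutive_pairing {α : Type*} {S T U : Finset α} (hd : Disjoint S T)
    (hU : U ⊆ S) (hcard : #U + #T = #S) :
    ∃ τ : α → α, Function.Involutive τ ∧ (∀ e ∈ T, τ e ∈ S) ∧ (∀ e, τ e ≠ e → e ∈ S ∨ e ∈ T) ∧
      ∀ e ∈ U, τ e = e := by
  classical
  have hc : #(S \ U) = #T := by rw [card_sdiff_of_subset hU]; omega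
  let φ := Finset.equivOfCardEq hc
  have hdis : ∀ e ∈ S \ U, e ∉ T := fun e he => disjoint_left.1 hd (mem_sdiff.1 he).1
  let τ : α → α := fun e => if h : e ∈ S \ U then (φ ⟨e, h⟩ : α) else
    if h : e ∈ T then (φ.symm ⟨e, h⟩ : α) else e
  have h1 : ∀ e (h : e ∈ S \ U), τ e = φ ⟨e, h⟩ := fun e h => dif_pos h
  have h2 : ∀ e (h : e ∈ T), τ e = φ.symm ⟨e, h⟩ := fun e h => by
    have : e ∉ S \ U := fun h' => hdis e h' h
    simp only [τ, dif_neg this, dif_pos h]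
  have h3 : ∀ e, e ∉ S \ U → e ∉ T → τ e = e := fun e h h' => by
    simp only [τ, dif_neg h, dif_neg h']
  refine ⟨τ, fun e => ?_, fun e he => ?_, fun e he => ?_, fun e he => ?_⟩
  · by_cases hS : e ∈ S \ U
    · rw [h1 e hS, h2 _ (φ ⟨e, hS⟩).2]; simp
    · by_cases hT : e ∈ T
      · rw [h2 e hT, h1 _ (φ.symm ⟨e, hT⟩).2]; simp
      · rw [h3 e hS hT, h3 e hS hT]
  · rw [h2 e he]
    exact (mem_sdiff.1 (φ.symm ⟨e, he⟩).2).1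
  · by_contra hcon
    push Not at hcon
    exact he (h3 e (fun h => hcon.1 (mem_sdiff.1 h).1) hcon.2)
  · refine h3 e (fun h => (mem_sdiff.1 h).2 he) (disjoint_left.1 hd (hU he))

/-- The graph on edges in which two edges are adjacent if they are paired at some vertex. -/
def pairingGraph {V : Type*} (τ : V → Sym2 V → Sym2 V) : SimpleGraph (Sym2 V) :=
  SimpleGraph.fromRel fun e e' => ∃ v, τ v e = e'

theorem pairingGraph_reachable {V : Type*} (τ : V → Sym2 V → Sym2 V) (v : V) (e : Sym2 V) :
    (pairingGraph τ).Reachable e (τ v e) := by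
  by_cases h : e = τ v e
  · rw [← h]
  · exact SimpleGraph.Adj.reachable ⟨h, Or.inl ⟨v, rfl⟩⟩

/-- A component of the pairing graph has at most two unpaired ends. -/
theorem not_three_ends_reachable {V : Type*} [Fintype V] [DecidableEq V]
    (τ : V → Sym2 V → Sym2 V) (hinv : ∀ v, Function.Involutive (τ v))
    (hmove : ∀ v e, τ v e ≠ e → v ∈ e)
    {x y z : V} {e₁ e₂ e₃ : Sym2 V} (hx : x ∈ e₁) (hy : y ∈ e₂) (hz : z ∈ e₃)
    (fx : τ x e₁ = e₁) (fy : τ y e₂ = e₂) (fz : τ z e₃ = e₃)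
    (h12 : (x, e₁) ≠ (y, e₂)) (h13 : (x, e₁) ≠ (z, e₃)) (h23 : (y, e₂) ≠ (z, e₃))
    (r12 : (pairingGraph τ).Reachable e₁ e₂) : ¬ (pairingGraph τ).Reachable e₁ e₃ := by
  classical
  intro r13
  let K := pairingGraph τ
  let C := K.connectedComponentMk e₁
  let J := C.toSimpleGraph
  -- Each of the at most two ends of `e` either is unpaired or accounts for at most one neighbour.
  have hdeg : ∀ e : C, J.degree e + #{v | v ∈ (e : Sym2 V) ∧ τ v e = e} ≤ 2 := by
    intro e
    have hsub : (J.neighborFinset e).image Subtype.val ⊆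
        ({v | v ∈ (e : Sym2 V) ∧ τ v e ≠ e} : Finset V).image (fun v => τ v e) := by
      intro e' he'
      obtain ⟨e'', h, rfl⟩ := mem_image.1 he'
      have h' : K.Adj e e'' := (J.mem_neighborFinset e e'').1 h
      have hne := h'.1
      have hv : ∃ v, τ v e = e'' := by
        rcases h'.2 with ⟨v, hv⟩ | ⟨v, hv⟩
        · exact ⟨v, hv⟩
        · exact ⟨v, by rw [← hv, hinv v]⟩
      obtain ⟨v, hv⟩ := hv
      have hne' : τ v e ≠ e := by rw [hv]; exact hne.symm
      exact mem_image.2 ⟨v, by simp [hmove v e hne', hne'], hv⟩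
    have h1 : J.degree e ≤ #{v | v ∈ (e : Sym2 V) ∧ τ v e ≠ e} := by
      rw [← SimpleGraph.card_neighborFinset_eq_degree,
        ← card_image_of_injective _ Subtype.val_injective]
      exact (card_le_card hsub).trans card_image_le
    have h2 : #{v | v ∈ (e : Sym2 V) ∧ τ v e = e} + #{v | v ∈ (e : Sym2 V) ∧ τ v e ≠ e} ≤ 2 := by
      rw [← card_union_of_disjoint]
      · refine (card_le_card (t := (e : Sym2 V).toFinset) fun v => ?_).trans ?_
        · simp only [mem_union, mem_filter, mem_univ, true_and, Sym2.mem_toFinset]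
          tauto
        rw [Sym2.card_toFinset]; split_ifs <;> norm_num
      · rw [disjoint_left]
        intro v hv hv'
        exact (mem_filter.1 hv').2.2 (mem_filter.1 hv).2.2
    omega
  have hC1 : e₁ ∈ C.supp := rfl
  have hC2 : e₂ ∈ C.supp := SimpleGraph.ConnectedComponent.sound r12.symm
  have hC3 : e₃ ∈ C.supp := SimpleGraph.ConnectedComponent.sound r13.symm
  have hends : 3 ≤ ∑ e : C, #{v | v ∈ (e : Sym2 V) ∧ τ v e = e} := by
    rw [← card_sigma]
    have h3 : #({⟨⟨e₁, hC1⟩, x⟩, ⟨⟨e₂, hC2⟩, y⟩, ⟨⟨e₃, hC3⟩, z⟩} : Finset (Σ _ : C, V)) = 3 := by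
      rw [card_eq_three]
      refine ⟨_, _, _, ?_, ?_, ?_, rfl⟩ <;> intro h <;> simp only [Sigma.mk.injEq,
        Subtype.mk.injEq, heq_eq_eq] at h
      · exact h12 (Prod.ext h.2 h.1)
      · exact h13 (Prod.ext h.2 h.1)
      · exact h23 (Prod.ext h.2 h.1)
    rw [← h3]
    refine card_le_card fun t ht => ?_
    simp only [mem_insert, mem_singleton] at ht
    rcases ht with rfl | rfl | rfl <;> simp [*]
  -- A connected graph on n vertices has degree sum at least 2n - 2, so the bound 2n leaves at most
  -- two unpaired ends.
  have hsum : ∑ e : C, (J.degree e + #{v | v ∈ (e : Sym2 V) ∧ τ v e = e}) ≤ ∑ _e : C, 2 :=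
    sum_le_sum fun e _ => hdeg e
  rw [sum_add_distrib, J.sum_degrees_eq_twice_card_edges] at hsum
  have hconn := (SimpleGraph.ConnectedComponent.connected_toSimpleGraph
    C).card_vert_le_card_edgeSet_add_one
  rw [Nat.card_eq_fintype_card, Nat.card_eq_fintype_card, ← SimpleGraph.edgeFinset_card] at hconn
  simp only [sum_const, card_univ, smul_eq_mul] at hsum
  change Fintype.card C ≤ #J.edgeFinset + 1 at hconn
  omega

/-! ### Colour multiplicities and Kempe exchange -/

open Classical in
/-- The colouring obtained from `c` by exchanging the colours `p` and `q` on `X`. -/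
noncomputable def swapOn {V C : Type*} [DecidableEq C] (X : Set (Sym2 V)) (p q : C)
    (c : Sym2 V → C) :
    Sym2 V → C := fun e => if e ∈ X then Equiv.swap p q (c e) else c e

theorem swapOn_comm {V C : Type*} [DecidableEq C] (X : Set (Sym2 V)) (p q : C)
    (c : Sym2 V → C) :
    swapOn X p q c = swapOn X q p c := by
  unfold swapOn; simp only [Equiv.swap_comm]

section Count

variable {V C : Type*} [DecidableEq V] [DecidableEq C]

/-- The number of edges in `E` at `v` that have colour `i`. -/
def colorCount (E : Finset (Sym2 V)) (c : Sym2 V → C) (v : V) (i : C) : ℕ :=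
  #{e ∈ E | v ∈ e ∧ c e = i}

/-- `c` is an `f`-colouring of the edge set `E`. -/
def IsEdgeColoring (E : Finset (Sym2 V)) (f : V → ℕ) (c : Sym2 V → C) : Prop :=
  ∀ v i, colorCount E c v i ≤ f v

theorem sum_colorCount [Fintype C] (E : Finset (Sym2 V)) (c : Sym2 V → C) (v : V) :
    ∑ i, colorCount E c v i = #{e ∈ E | v ∈ e} := by
  rw [card_eq_sum_card_fiberwise (f := c) (t := univ) (by intro; simp)]
  simp only [colorCount, filter_filter]

theorem colorCount_swapOn_of_ne (E : Finset (Sym2 V)) (X : Set (Sym2 V)) {p q i : C}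
    (c : Sym2 V → C) (v : V) (hp : i ≠ p) (hq : i ≠ q) :
    colorCount E (swapOn X p q c) v i = colorCount E c v i := by
  unfold colorCount
  congr 1
  refine filter_congr fun e _ => and_congr_right fun _ => ?_
  unfold swapOn
  split_ifs
  · rw [← Equiv.eq_symm_apply, Equiv.symm_swap, Equiv.swap_apply_of_ne_of_ne hp hq]
  · rfl

open Classical in
theorem colorCount_swapOn_left (E : Finset (Sym2 V)) (X : Set (Sym2 V)) (p q : C)
    (c : Sym2 V → C) (v : V) :
    colorCount E (swapOn X p q c) v p =
      #{e ∈ {e ∈ E | v ∈ e ∧ c e = p} | e ∉ X} + #{e ∈ {e ∈ E | v ∈ e ∧ c e = q} | e ∈ X} := by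
  rw [← card_union_of_disjoint]
  · unfold colorCount
    congr 1
    ext e
    rw [mem_filter, mem_union, mem_filter, mem_filter, mem_filter, mem_filter]
    by_cases h : e ∈ X
    · simp [h, swapOn, ← Equiv.eq_symm_apply]
    · simp [h, swapOn]
  · rw [disjoint_left]
    intro e
    simp only [mem_filter]
    tauto

open Classical in
theorem colorCount_split (E : Finset (Sym2 V)) (X : Set (Sym2 V)) (c : Sym2 V → C) (v : V)
    (p : C) : colorCount E c v p =
      #{e ∈ {e ∈ E | v ∈ e ∧ c e = p} | e ∈ X} + #{e ∈ {e ∈ E | v ∈ e ∧ c e = p} | e ∉ X} :=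
  (card_filter_add_card_filter_not (s := {e ∈ E | v ∈ e ∧ c e = p}) (· ∈ X)).symm

theorem colorCount_swapOn_add (E : Finset (Sym2 V)) (X : Set (Sym2 V)) (p q : C)
    (c : Sym2 V → C) (v : V) :
    colorCount E (swapOn X p q c) v p + colorCount E (swapOn X p q c) v q =
      colorCount E c v p + colorCount E c v q := by
  rw [colorCount_swapOn_left E X p q, swapOn_comm, colorCount_swapOn_left E X q p,
    colorCount_split E X c v p, colorCount_split E X c v q]
  ring

/-- At a vertex `v` where `p` is the majority colour, a pairing `τ` of the edges coloured `p` and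
`q` is given.  Exchanging the colours on a set closed under `τ` keeps both multiplicities at most
that of `p`. -/
theorem colorCount_swapOn_le (E : Finset (Sym2 V)) {X : Set (Sym2 V)} {p q : C} (hpq : p ≠ q)
    (c : Sym2 V → C) (v : V) {τ : Sym2 V → Sym2 V} (hτ : Function.Involutive τ)
    (hTS : ∀ e ∈ ({e ∈ E | v ∈ e ∧ c e = q} : Finset _),
      τ e ∈ ({e ∈ E | v ∈ e ∧ c e = p} : Finset _))
    (hX : ∀ e, τ e ∈ X ↔ e ∈ X) :
    colorCount E (swapOn X p q c) v p ≤ colorCount E c v p ∧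
    colorCount E (swapOn X p q c) v q ≤ colorCount E c v p ∧
    ∀ e₀ ∈ ({e ∈ E | v ∈ e ∧ c e = p} : Finset _), τ e₀ = e₀ →
      (e₀ ∈ X → colorCount E (swapOn X p q c) v p < colorCount E c v p) ∧
      (e₀ ∉ X → colorCount E (swapOn X p q c) v q < colorCount E c v p) := by
  classical
  have h0 : ∀ e ∈ ({e ∈ E | v ∈ e ∧ c e = p} : Finset _),
      e ∉ ({e ∈ E | v ∈ e ∧ c e = q} : Finset _) := by
    intro e he he'
    exact hpq ((mem_filter.1 he).2.2.symm.trans (mem_filter.1 he').2.2)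
  have hX' : ∀ e, τ e ∉ X ↔ e ∉ X := fun e => not_congr (hX e)
  have h1 := card_filter_le_of_involutive hτ hTS (· ∈ X) hX
  have h2 := card_filter_le_of_involutive hτ hTS (· ∉ X) hX'
  have e1 := colorCount_swapOn_left E X p q c v
  have e2 := colorCount_swapOn_left E X q p c v
  rw [swapOn_comm] at e2
  have e3 := colorCount_split E X c v p
  refine ⟨by omega, by omega, fun e₀ he₀ hfix => ⟨fun hin => ?_, fun hin => ?_⟩⟩
  · have := card_filter_lt_of_involutive hτ hTS (· ∈ X) hX he₀ (h0 e₀ he₀) hfix hin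
    omega
  · have := card_filter_lt_of_involutive hτ hTS (· ∉ X) hX' he₀ (h0 e₀ he₀) hfix hin
    omega

/-- Kempe exchange.  Let `b` be missing at `x` relative to `a`, let `ex` be an edge at `x` of
colour `a`, and let there be two ends at `y` and `y'` where `b` exceeds `a`.  Then for one of these
two vertices colours can be exchanged so that `b` becomes rarer there, keeping the colour of `ex`
and keeping `b` rarer at `x` than `a` was. -/
theorem exists_kempe_exchange [Fintype V] {E : Finset (Sym2 V)} {f : V → ℕ} {c : Sym2 V → C}
    (hc : IsEdgeColoring E f c) {a b : C} (hab : a ≠ b) {x y y' : V} {ex : Sym2 V} (hexE : ex ∈ E)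
    (hxex : x ∈ ex) (hcex : c ex = a) (hx : colorCount E c x b < colorCount E c x a)
    (hy : colorCount E c y a < colorCount E c y b)
    (hy' : colorCount E c y' a < colorCount E c y' b)
    (hyy' : y = y' → colorCount E c y a + 2 ≤ colorCount E c y b) :
    ∃ u, (u = y ∨ u = y') ∧ ∃ c' : Sym2 V → C, IsEdgeColoring E f c' ∧
      (∀ e, c e ≠ a → c e ≠ b → c' e = c e) ∧ c' ex = a ∧
      (∀ v i, i ≠ a → i ≠ b → colorCount E c' v i = colorCount E c v i) ∧
      (∀ v, colorCount E c' v a + colorCount E c' v b =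
        colorCount E c v a + colorCount E c v b) ∧
      colorCount E c' x b < colorCount E c x a ∧ colorCount E c' u b < colorCount E c u b := by
  classical
  have hpair : ∀ v, ∃ (p q : C) (τ : Sym2 V → Sym2 V) (U : Finset (Sym2 V)),
      (p = a ∧ q = b ∨ p = b ∧ q = a) ∧ Function.Involutive τ ∧
      (∀ e ∈ ({e ∈ E | v ∈ e ∧ c e = q} : Finset _),
        τ e ∈ ({e ∈ E | v ∈ e ∧ c e = p} : Finset _)) ∧
      (∀ e, τ e ≠ e → v ∈ e) ∧ U ⊆ ({e ∈ E | v ∈ e ∧ c e = p} : Finset _) ∧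
      (∀ e ∈ U, τ e = e) ∧ #U + colorCount E c v q = colorCount E c v p ∧
      (v = x → ex ∈ U) := by
    intro v
    obtain ⟨p, q, hpq, hle⟩ : ∃ p q : C, (p = a ∧ q = b ∨ p = b ∧ q = a) ∧
        colorCount E c v q ≤ colorCount E c v p := by
      rcases le_total (colorCount E c v b) (colorCount E c v a) with h | h
      · exact ⟨a, b, by simp, h⟩
      · exact ⟨b, a, by simp, h⟩
    have hne : p ≠ q := by rcases hpq with ⟨rfl, rfl⟩ | ⟨rfl, rfl⟩; exacts [hab, hab.symm]
    -- At `x`, `ex` is forced to be unpaired; there is room for this because `b` is strictly rarer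
    -- than `a` there.
    let U₀ : Finset (Sym2 V) := if v = x then {ex} else ∅
    have hU₀ : U₀ ⊆ ({e ∈ E | v ∈ e ∧ c e = p} : Finset _) ∧
        #U₀ ≤ colorCount E c v p - colorCount E c v q := by
      by_cases hv : v = x
      · subst hv
        have hp : p = a ∧ q = b := by
          rcases hpq with h | ⟨rfl, rfl⟩
          · exact h
          · omega
        simp only [U₀, if_true, singleton_subset_iff, mem_filter, card_singleton]
        refine ⟨⟨hexE, hxex, by rw [hcex, hp.1]⟩, ?_⟩
        rw [hp.1, hp.2]; omega
      · simp [U₀, hv]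
    obtain ⟨U, hU₀U, hU, hUc⟩ := exists_subsuperset_card_eq hU₀.1 hU₀.2 (Nat.sub_le _ _)
    have hUc' : #U + colorCount E c v q = colorCount E c v p := by omega
    obtain ⟨τ, h1, h2, h3, h4⟩ := exists_involutive_pairing
      (S := ({e ∈ E | v ∈ e ∧ c e = p} : Finset _)) (T := ({e ∈ E | v ∈ e ∧ c e = q} : Finset _))
      (by
        rw [disjoint_left]
        intro e he he'
        exact hne ((mem_filter.1 he).2.2.symm.trans (mem_filter.1 he').2.2)) hU hUc'
    refine ⟨p, q, τ, U, hpq, h1, h2, fun e he => ?_, hU, h4, hUc', fun hv => hU₀U ?_⟩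
    · rcases h3 e he with h | h <;> exact (mem_filter.1 h).2.1
    · simp [U₀, hv]
  choose p q τ U hpq hinv hTS hmove hUsub hfix hUcard hUx using hpair
  have hne : ∀ v, p v ≠ q v := fun v => by
    rcases hpq v with ⟨h1, h2⟩ | ⟨h1, h2⟩ <;> rw [h1, h2]
    exacts [hab, hab.symm]
  have hmaj : ∀ v, colorCount E c v a < colorCount E c v b → p v = b ∧ q v = a := by
    intro v hv
    rcases hpq v with ⟨h1, h2⟩ | h
    · have := hUcard v
      rw [h1, h2] at this; omega
    · exact h
  obtain ⟨e₂, e₃, he₂, he₃, h23⟩ : ∃ e₂ e₃, e₂ ∈ U y ∧ e₃ ∈ U y' ∧ (y, e₂) ≠ (y', e₃) := by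
    have hc1 := hUcard y
    have hc2 := hUcard y'
    rw [(hmaj y hy).1, (hmaj y hy).2] at hc1
    rw [(hmaj y' hy').1, (hmaj y' hy').2] at hc2
    by_cases h : y = y'
    · subst h
      have := hyy' rfl
      obtain ⟨e₂, he₂, e₃, he₃, hne⟩ := one_lt_card.1 (show 1 < #(U y) by omega)
      exact ⟨e₂, e₃, he₂, he₃, by simpa using hne⟩
    · obtain ⟨e₂, he₂⟩ := card_pos.1 (show 0 < #(U y) by omega)
      obtain ⟨e₃, he₃⟩ := card_pos.1 (show 0 < #(U y') by omega)
      exact ⟨e₂, e₃, he₂, he₃, by simp [h]⟩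
  have hyx : y ≠ x := by rintro rfl; omega
  have hy'x : y' ≠ x := by rintro rfl; omega
  -- The chain of `ex` already has the end at `x`, so it cannot contain both other ends. The chain
  -- of one that it misses is exchanged.
  have key : ∃ u e, (u = y ∨ u = y') ∧ e ∈ U u ∧ ¬ (pairingGraph τ).Reachable ex e := by
    by_cases r : (pairingGraph τ).Reachable ex e₂
    · refine ⟨y', e₃, Or.inr rfl, he₃, ?_⟩
      exact not_three_ends_reachable τ hinv hmove hxex (mem_filter.1 (hUsub y he₂)).2.1
        (mem_filter.1 (hUsub y' he₃)).2.1 (hfix x ex (hUx x rfl)) (hfix y e₂ he₂)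
        (hfix y' e₃ he₃) (by simp [hyx.symm]) (by simp [hy'x.symm]) h23 r
    · exact ⟨y, e₂, Or.inl rfl, he₂, r⟩
  obtain ⟨u, e, hu, heU, hnr⟩ := key
  let X : Set (Sym2 V) := {e' | (pairingGraph τ).Reachable e e'}
  have hXe : e ∈ X := SimpleGraph.Reachable.refl e
  have hXex : ex ∉ X := fun h => hnr (SimpleGraph.Reachable.symm h)
  have hX : ∀ v e', τ v e' ∈ X ↔ e' ∈ X := fun v e' =>
    ⟨fun h => SimpleGraph.Reachable.trans h (pairingGraph_reachable τ v e').symm,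
     fun h => SimpleGraph.Reachable.trans h (pairingGraph_reachable τ v e')⟩
  have hsw : ∀ v, swapOn X (p v) (q v) c = swapOn X a b c := fun v => by
    rcases hpq v with ⟨h1, h2⟩ | ⟨h1, h2⟩ <;> rw [h1, h2]
    exact swapOn_comm _ _ _ _
  have hloc := fun v => colorCount_swapOn_le E (hne v) c v (hinv v) (hTS v) (hX v)
  simp only [hsw] at hloc
  refine ⟨u, hu, swapOn X a b c, fun v i => ?_, fun e' ha hb => ?_, ?_, fun v i hi hi' =>
    colorCount_swapOn_of_ne E X c v hi hi', colorCount_swapOn_add E X a b c, ?_, ?_⟩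
  · have hfp := hc v (p v)
    by_cases hip : i = p v
    · rw [hip]; exact (hloc v).1.trans hfp
    · by_cases hiq : i = q v
      · rw [hiq]; exact (hloc v).2.1.trans hfp
      · rw [← hsw v, colorCount_swapOn_of_ne E X c v hip hiq]
        exact hc v i
  · unfold swapOn
    split_ifs
    · exact Equiv.swap_apply_of_ne_of_ne ha hb
    · rfl
  · unfold swapOn
    rw [if_neg hXex, hcex]
  · have hp : p x = a ∧ q x = b := by
      rcases hpq x with h | ⟨h1, h2⟩
      · exact h
      · have := hUcard x
        rw [h1, h2] at this; omega
    have := ((hloc x).2.2 ex (hUsub x (hUx x rfl)) (hfix x ex (hUx x rfl))).2 hXex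
    rwa [hp.1, hp.2] at this
  · have hub : p u = b := by
      rcases hu with rfl | rfl
      exacts [(hmaj _ hy).1, (hmaj _ hy').1]
    have := ((hloc u).2.2 e (hUsub u heU) (hfix u e heU)).1 hXe
    rwa [hub] at this

end Count

/-! ### Fans and the adjacency lemma -/

section Fan

variable {V C : Type*} [DecidableEq V] [DecidableEq C]

theorem colorCount_insert_update {E : Finset (Sym2 V)} {e : Sym2 V} (he : e ∉ E)
    (c : Sym2 V → C) (a : C) (v : V) (i : C) :
    colorCount (insert e E) (Function.update c e a) v i =
      colorCount E c v i + if v ∈ e ∧ a = i then 1 else 0 := by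
  have h : ({e' ∈ E | v ∈ e' ∧ Function.update c e a e' = i} : Finset _) =
      {e' ∈ E | v ∈ e' ∧ c e' = i} := by
    refine filter_congr fun e' he' => ?_
    rw [Function.update_of_ne (by rintro rfl; exact he he')]
  unfold colorCount
  rw [filter_insert, Function.update_self]
  split_ifs with h'
  · rw [card_insert_of_notMem (by simp [he]), h]
  · rw [h, add_zero]

theorem colorCount_erase {E : Finset (Sym2 V)} {e : Sym2 V} (he : e ∈ E)
    (c : Sym2 V → C) (v : V) (i : C) :
    colorCount E c v i = colorCount (E.erase e) c v i + if v ∈ e ∧ c e = i then 1 else 0 := by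
  have := colorCount_insert_update (notMem_erase e E) c (c e) v i
  rwa [insert_erase he, Function.update_eq_self] at this

/-- If an uncoloured edge `e` has both ends missing colour `b`, it can be coloured `b`. -/
theorem IsEdgeColoring.update_of_missing {E : Finset (Sym2 V)} {f : V → ℕ} {c : Sym2 V → C}
    {e : Sym2 V} (he : e ∈ E) (hc : IsEdgeColoring (E.erase e) f c) {b : C}
    (hb : ∀ v ∈ e, colorCount (E.erase e) c v b < f v) :
    IsEdgeColoring E f (Function.update c e b) := by
  intro v i
  have := colorCount_insert_update (notMem_erase e E) c b v i
  rw [insert_erase he] at this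
  rw [this]
  split_ifs with h
  · exact h.2 ▸ hb v h.1
  · exact hc v i

/-- Shifting colours along a fan at `x` that starts with the uncoloured edge `xw` and ends at a
vertex missing a colour `b` that is also missing at `x`. -/
theorem exists_isEdgeColoring_of_fan {E : Finset (Sym2 V)} {f : V → ℕ} {x : V} {b : C} :
    ∀ (l : List V) (w : V) (c : Sym2 V → C), s(x, w) ∈ E →
      IsEdgeColoring (E.erase s(x, w)) f c → (w :: l).Nodup →
      (w :: l).IsChain (fun u v => s(x, v) ∈ E ∧
        (colorCount (E.erase s(x, w)) c u b < f u ∨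
          colorCount (E.erase s(x, w)) c u (c s(x, v)) < f u)) →
      colorCount (E.erase s(x, w)) c x b < f x →
      (∀ y ∈ (w :: l).getLast?, colorCount (E.erase s(x, w)) c y b < f y) →
      ∃ c' : Sym2 V → C, IsEdgeColoring E f c' := by
  intro l
  induction l with
  | nil =>
    intro w c hw hc _ _ hx hl
    refine ⟨_, hc.update_of_missing (b := b) hw fun v hv => ?_⟩
    rcases Sym2.mem_iff.1 hv with rfl | rfl
    exacts [hx, hl _ (by simp)]
  | cons v l ih =>
    intro w c hw hc hnd hch hx hl
    -- The fan may stop early: if `w` already misses `b`, the edge `xw` takes colour `b` at once.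
    by_cases hwb : colorCount (E.erase s(x, w)) c w b < f w
    · refine ⟨_, hc.update_of_missing (b := b) hw fun u hu => ?_⟩
      rcases Sym2.mem_iff.1 hu with rfl | rfl
      exacts [hx, hwb]
    rw [List.isChain_cons_cons] at hch
    obtain ⟨⟨hv, hmiss⟩, hch⟩ := hch
    have hmiss := hmiss.resolve_left hwb
    rw [List.nodup_cons] at hnd
    have hwv : w ≠ v := fun h => hnd.1 (by simp [h])
    have hne : s(x, v) ≠ s(x, w) := fun h => hwv (Sym2.congr_right.1 h).symm
    let a := c s(x, v)
    let E₀ := (E.erase s(x, w)).erase s(x, v)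
    let c₁ := Function.update c s(x, w) a
    have k1 : ∀ u i, colorCount (E.erase s(x, w)) c u i =
        colorCount E₀ c u i + if u ∈ s(x, v) ∧ a = i then 1 else 0 := fun u i =>
      colorCount_erase (mem_erase.2 ⟨hne, hv⟩) c u i
    have k2 : ∀ u i, colorCount (E.erase s(x, v)) c₁ u i =
        colorCount E₀ c u i + if u ∈ s(x, w) ∧ a = i then 1 else 0 := fun u i => by
      have h : insert s(x, w) E₀ = E.erase s(x, v) := by
        simp only [E₀]
        rw [erase_right_comm, insert_erase (mem_erase.2 ⟨hne.symm, hw⟩)]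
      rw [← h]
      exact colorCount_insert_update (by simp [E₀]) c a u i
    -- Moving colour `a` from `xv` to `xw` leaves the counts at `x` unchanged and lowers one at `v`;
    -- only at `w` can a count grow.
    have k3 : ∀ u i, u ≠ w →
        colorCount (E.erase s(x, v)) c₁ u i ≤ colorCount (E.erase s(x, w)) c u i := by
      intro u i hu
      rw [k1, k2]
      have : u ∈ s(x, w) → u ∈ s(x, v) := fun h => by
        rcases Sym2.mem_iff.1 h with rfl | rfl
        · simp
        · exact absurd rfl hu
      refine Nat.add_le_add_left ?_ _
      split_ifs <;> first | omega | tauto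
    have k4 : ∀ u i, u ≠ w → colorCount (E.erase s(x, w)) c u i < f u →
        colorCount (E.erase s(x, v)) c₁ u i < f u := fun u i hu h => (k3 u i hu).trans_lt h
    have hmem : ∀ u ∈ v :: l, u ≠ w := fun u hu h => hnd.1 (h ▸ hu)
    refine ih v c₁ hv (fun u i => ?_) hnd.2 ?_ ?_ ?_
    · by_cases hu : u = w
      · rw [k2]
        split_ifs with h
        · have h1 := k1 u i
          rw [← h.2] at h1 ⊢
          rw [hu] at h1 ⊢
          change colorCount (E.erase s(x, w)) c w a < f w at hmiss
          omega
        · exact (Nat.le_add_right _ _).trans ((k1 u i).symm.le.trans (hc u i))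
      · exact (k3 u i hu).trans (hc u i)
    · refine hch.imp_of_mem_imp fun u z hu hz h => ⟨h.1, ?_⟩
      have hcz : c₁ s(x, z) = c s(x, z) := Function.update_of_ne
        (fun h => hmem z hz (Sym2.congr_right.1 h)) _ _
      rw [hcz]
      exact h.2.imp (k4 u _ (hmem u hu)) (k4 u _ (hmem u hu))
    -- `E` is an arbitrary set of unordered pairs, so `xw` may be a loop.
    · by_cases hxw : x = w
      · subst hxw
        have h1 := k1 x b
        have h2 := k2 x b
        simp only [Sym2.mem_mk_left, true_and] at h1 h2
        omega
      · exact k4 x b hxw hx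
    · intro y hy
      refine k4 y b (hmem y (List.mem_of_getLast? hy)) (hl y ?_)
      simpa using hy

/-- The vertices reached by a fan at `x` starting at `w`, where `φ i` is the only neighbour of `x`
that may be reached through colour `i`. -/
def FanVertex (E : Finset (Sym2 V)) (f : V → ℕ) (c : Sym2 V → C) (x w : V) (φ : C → V)
    (y : V) : Prop :=
  ∃ l : List V, l.Nodup ∧ l.head? = some w ∧ l.getLast? = some y ∧
    l.IsChain fun u v => s(x, v) ∈ E ∧
      colorCount (E.erase s(x, w)) c u (c s(x, v)) < f u ∧ φ (c s(x, v)) = v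

theorem FanVertex.of_mem {E : Finset (Sym2 V)} {f : V → ℕ} {c : Sym2 V → C} {x w : V} {φ : C → V}
    {l : List V} (hnd : l.Nodup) (hhd : l.head? = some w)
    (hch : l.IsChain fun u v => s(x, v) ∈ E ∧
      colorCount (E.erase s(x, w)) c u (c s(x, v)) < f u ∧ φ (c s(x, v)) = v)
    {y : V} (hy : y ∈ l) : FanVertex E f c x w φ y := by
  obtain ⟨s, t, rfl⟩ := List.mem_iff_append.1 hy
  have e : s ++ y :: t = (s ++ [y]) ++ t := by simp
  rw [e] at hnd hch hhd
  refine ⟨s ++ [y], hnd.of_append_left, ?_, by simp, hch.left_of_append⟩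
  rw [← hhd]
  cases s <;> simp

theorem fanVertex_self (E : Finset (Sym2 V)) (f : V → ℕ) (c : Sym2 V → C) (x w : V) (φ : C → V) :
    FanVertex E f c x w φ w := ⟨[w], by simp, by simp, by simp, by simp⟩

/-- If `φ i` already lies on the fan, a prefix ends there; otherwise it can be appended without
repetition. -/
theorem FanVertex.step {E : Finset (Sym2 V)} {f : V → ℕ} {c : Sym2 V → C} {x w : V} {φ : C → V}
    {y : V} (hy : FanVertex E f c x w φ y) {i : C}
    (hi : colorCount (E.erase s(x, w)) c y i < f y) (hE : s(x, φ i) ∈ E)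
    (hci : c s(x, φ i) = i) : FanVertex E f c x w φ (φ i) := by
  obtain ⟨l, hnd, hhd, hlast, hch⟩ := hy
  by_cases hmem : φ i ∈ l
  · exact FanVertex.of_mem hnd hhd hch hmem
  · refine ⟨l ++ [φ i], ?_, ?_, by simp, ?_⟩
    · rw [List.nodup_append]
      exact ⟨hnd, by simp, by rintro a ha b hb rfl; simp at hb; exact hmem (hb ▸ ha)⟩
    · rw [List.head?_append, hhd]; rfl
    · refine hch.append (List.isChain_singleton _) ?_
      intro u hu v hv
      simp only [List.head?_cons, Option.mem_def, Option.some.injEq] at hv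
      rw [hlast] at hu
      obtain rfl : y = u := by simpa using hu
      subst hv
      rw [hci]
      exact ⟨hE, hi, rfl⟩

/-- Fan shifting for a colouring `c'` that arises from `c` in such a way that the fan persists up
to the first vertex missing `b`. -/
theorem exists_isEdgeColoring_of_fanVertex {E : Finset (Sym2 V)} {f : V → ℕ} {c c' : Sym2 V → C}
    {x w : V} {φ : C → V} {b : C} {y : V} (hy : FanVertex E f c x w φ y) (hw : s(x, w) ∈ E)
    (hc' : IsEdgeColoring (E.erase s(x, w)) f c')
    (hstep : ∀ u v, FanVertex E f c x w φ u → s(x, v) ∈ E → v ≠ w →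
      colorCount (E.erase s(x, w)) c u (c s(x, v)) < f u → φ (c s(x, v)) = v →
      colorCount (E.erase s(x, w)) c' u b < f u ∨
        colorCount (E.erase s(x, w)) c' u (c' s(x, v)) < f u)
    (hx : colorCount (E.erase s(x, w)) c' x b < f x)
    (hyb : colorCount (E.erase s(x, w)) c' y b < f y) :
    ∃ c'' : Sym2 V → C, IsEdgeColoring E f c'' := by
  obtain ⟨l, hnd, hhd, hlast, hch⟩ := hy
  cases l with
  | nil => simp at hhd
  | cons w' l =>
    obtain rfl : w' = w := by simpa using hhd
    refine exists_isEdgeColoring_of_fan l w' c' hw hc' hnd ?_ hx (fun z hz => ?_)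
    · refine hch.imp_of_mem_tail_imp fun u v hu hv h => ⟨h.1, hstep u v
        (FanVertex.of_mem hnd hhd hch ?_) h.1 ?_ h.2.1 h.2.2⟩
      · exact hu
      · rintro rfl
        exact (List.nodup_cons.1 hnd).1 hv
    · rw [hlast] at hz
      obtain rfl : y = z := by simpa using hz
      exact hyb

/-- Adjacency lemma for `f`-colourings: if `E` has no `f`-colouring but `E` without the edge `xw`
has one, then `x` has many neighbours of maximum degree apart from `w`. -/
theorem adjacency_lemma [Fintype V] [Fintype C] {E : Finset (Sym2 V)} {f : V → ℕ}
    (hf : ∀ v, 0 < f v) (hdeg : ∀ v, #{e ∈ E | v ∈ e} ≤ Fintype.card C * f v) {x w : V}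
    (hw : s(x, w) ∈ E) {c : Sym2 V → C} (hc : IsEdgeColoring (E.erase s(x, w)) f c)
    (hno : ¬ ∃ c' : Sym2 V → C, IsEdgeColoring E f c') :
    Fintype.card C * f w + 1 ≤ #{e ∈ E | w ∈ e} +
      #{z | z ≠ w ∧ s(x, z) ∈ E ∧ #{e ∈ E | z ∈ e} = Fintype.card C * f z} := by
  classical
  set E' := E.erase s(x, w) with hE'
  let slack : V → C → ℕ := fun v i => f v - colorCount E' c v i
  have hslack : ∀ v, ∑ i, slack v i + #{e ∈ E' | v ∈ e} = Fintype.card C * f v := by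
    intro v
    rw [← sum_colorCount E' c v, ← sum_add_distrib, sum_congr rfl
      (fun i _ => Nat.sub_add_cancel (hc v i))]
    simp
  have hdegE' : ∀ v ∈ s(x, w), #{e ∈ E' | v ∈ e} + 1 = #{e ∈ E | v ∈ e} := by
    intro v hv
    have : ({e ∈ E' | v ∈ e} : Finset _) = ({e ∈ E | v ∈ e} : Finset _).erase s(x, w) := by
      ext e; simp [hE', and_assoc]
    rw [this, card_erase_add_one (by simp only [mem_filter]; exact ⟨hw, hv⟩)]
  have hdegE'_le : ∀ v, #{e ∈ E' | v ∈ e} ≤ #{e ∈ E | v ∈ e} := fun v =>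
    card_le_card (filter_subset_filter _ (erase_subset _ _))
  -- The uncoloured edge `xw` leaves spare capacity at `x`.
  obtain ⟨b, hb⟩ : ∃ b, colorCount E' c x b < f x := by
    by_contra! hcon
    have h0 : ∑ i, slack x i = 0 := sum_eq_zero fun i _ => Nat.sub_eq_zero_of_le (hcon i)
    have := hslack x
    have := hdegE' x (by simp)
    have := hdeg x
    omega
  have hφ : ∀ i, ∃ z, ¬ colorCount E' c x i < f x → s(x, z) ∈ E' ∧ c s(x, z) = i := by
    intro i
    by_cases h : colorCount E' c x i < f x
    -- Arbitrary value: `φ i` matters only for colours saturated at `x`.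
    · exact ⟨x, fun h' => absurd h h'⟩
    · have hpos : 0 < colorCount E' c x i := (hf x).trans_le (not_lt.1 h)
      obtain ⟨e, he⟩ := card_pos.1 hpos
      obtain ⟨he, hxe, hce⟩ := mem_filter.1 he
      obtain ⟨z, rfl⟩ := Sym2.mem_iff_exists.1 hxe
      exact ⟨z, fun _ => ⟨he, hce⟩⟩
  choose φ hφ using hφ
  let P := FanVertex E f c x w φ
  -- Otherwise shifting along the fan would colour all of `E`.
  have hP : ∀ y, P y → ∀ i, colorCount E' c x i < f x → ¬ colorCount E' c y i < f y := by
    intro y hy i hxi hyi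
    exact hno (exists_isEdgeColoring_of_fanVertex hy hw hc (fun u v _ _ _ h _ => Or.inr h) hxi hyi)
  have hmiss : ∀ y, P y → ∀ i, colorCount E' c y i < f y →
      s(x, φ i) ∈ E' ∧ c s(x, φ i) = i := fun y hy i hi => hφ i fun h => hP y hy i h hi
  -- no colour is missing twice in the fan
  have htwo : ∀ a y y', P y → P y' → 0 < slack y a → 0 < slack y' a →
      (y = y' → 2 ≤ slack y a) → False := by
    intro a y y' hy hy' h1 h2 h3
    have h1' : colorCount E' c y a < f y := by simp only [slack] at h1; omega
    have h2' : colorCount E' c y' a < f y' := by simp only [slack] at h2; omega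
    have hxa : ¬ colorCount E' c x a < f x := fun h => hP y hy a h h1'
    have hab : a ≠ b := by rintro rfl; exact hxa hb
    have hyb := not_lt.1 (hP y hy b hb)
    have hyb' := not_lt.1 (hP y' hy' b hb)
    obtain ⟨hzE, hza⟩ := hmiss y hy a h1'
    obtain ⟨u, hu, c', hc', hsame, hza', hcount, hsum, hxb, hub⟩ := exists_kempe_exchange hc hab hzE
      (Sym2.mem_mk_left _ _) hza (hb.trans_le (not_lt.1 hxa)) (h1'.trans_le hyb)
      (h2'.trans_le hyb') (fun h => by have := h3 h; simp only [slack] at this; omega)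
    have hPu : P u := by rcases hu with rfl | rfl <;> assumption
    refine hno (exists_isEdgeColoring_of_fanVertex (b := b) (y := u) hPu hw hc' ?_
      (hxb.trans_le (hc x a)) (hub.trans_le (hc u b)))
    intro v z hv hz hzw hvz hφz
    rw [← hE'] at hvz ⊢
    by_cases h : colorCount E' c' v b < f v
    · exact Or.inl h
    right
    have hcb : c s(x, z) ≠ b := fun h' => hP v hv b hb (h' ▸ hvz)
    by_cases hca : c s(x, z) = a
    -- The fan reaches colour `a` only through the edge to `φ a`, which kept its colour. The
    -- combined count of `a` and `b` at `v` is unchanged, so with `b` now saturated there, `a` is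
    -- still missing.
    · rw [hca] at hvz hφz
      rw [← hφz, hza']
      have := hsum v
      have := hc v b
      omega
    · rw [hsame _ hca hcb, hcount v _ hca hcb]
      exact hvz
  let F : Finset V := {y | P y}
  let N : Finset V := {z | z ≠ w ∧ s(x, z) ∈ E ∧ P z}
  have hle1 : ∀ a, ∑ y ∈ F, slack y a ≤ 1 := by
    intro a
    have hP' : ∀ {y}, y ∈ F → P y := fun hy => (mem_filter.1 hy).2
    by_contra! hcon
    have hone : ∀ y ∈ F, slack y a ≤ 1 := by
      intro y hy
      by_contra! h
      exact htwo a y y (hP' hy) (hP' hy) (by omega) (by omega) (fun _ => h)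
    have hlt : 1 < #{y ∈ F | 0 < slack y a} := by
      refine hcon.trans_le ?_
      rw [card_filter]
      refine sum_le_sum fun y hy => ?_
      have := hone y hy
      split_ifs <;> omega
    obtain ⟨y, hy, y', hy', hne⟩ := one_lt_card.1 hlt
    rw [mem_filter] at hy hy'
    exact htwo a y y' (hP' hy.1) (hP' hy'.1) hy.2 hy'.2 (fun h => absurd h hne)
  -- Each colour missing in the fan is missing once and leads through `φ` to its own fan vertex
  -- other than `w`.
  have hA : ∑ a, ∑ y ∈ F, slack y a ≤ #N := by
    have h1 : ∑ a, ∑ y ∈ F, slack y a ≤ #{a | 0 < ∑ y ∈ F, slack y a} := by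
      rw [card_filter]
      refine sum_le_sum fun a _ => ?_
      have := hle1 a
      split_ifs <;> omega
    refine h1.trans ?_
    have hkey : ∀ a, 0 < ∑ y ∈ F, slack y a →
        (s(x, φ a) ∈ E' ∧ c s(x, φ a) = a) ∧ P (φ a) := by
      intro a ha
      obtain ⟨y, hy, hpos⟩ := exists_ne_zero_of_sum_ne_zero ha.ne'
      have hy := (mem_filter.1 hy).2
      have hya : colorCount E' c y a < f y := by simp only [slack] at hpos; omega
      have hm := hmiss y hy a hya
      exact ⟨hm, FanVertex.step hy hya (mem_of_mem_erase hm.1) hm.2⟩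
    refine card_le_card_of_injOn φ (fun a ha => ?_) (fun a ha a' ha' h => ?_)
    · obtain ⟨h1, h2⟩ := hkey a (mem_filter.1 ha).2
      refine mem_coe.2 (mem_filter.2 ⟨mem_univ _, ?_, mem_of_mem_erase h1.1, h2⟩)
      intro h
      exact (mem_erase.1 h1.1).1 (by rw [h])
    · rw [← (hkey a (mem_filter.1 ha).2).1.2, ← (hkey a' (mem_filter.1 ha').2).1.2, h]
  rw [sum_comm] at hA
  have hwN : w ∉ N := by simp [N]
  have hsub : insert w N ⊆ F := by
    intro y hy
    rcases mem_insert.1 hy with rfl | hy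
    · exact mem_filter.2 ⟨mem_univ _, fanVertex_self _ _ _ _ _ _⟩
    · exact mem_filter.2 ⟨mem_univ _, (mem_filter.1 hy).2.2.2⟩
  have h2 := (sum_le_sum_of_subset hsub (f := fun y => ∑ a, slack y a)).trans hA
  rw [sum_insert hwN] at h2
  -- Every fan vertex of non-maximum degree has slack at least 1, while `w` has slack k f(w) -
  -- d_E(w) + 1; the total is at most `#N`.
  have h3 : #{z ∈ N | ¬ #{e ∈ E | z ∈ e} = Fintype.card C * f z} ≤ ∑ y ∈ N, ∑ a, slack y a := by
    rw [card_filter]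
    refine sum_le_sum fun y _ => ?_
    have := hslack y
    have := hdeg y
    have := hdegE'_le y
    split_ifs <;> omega
  have h4 := card_filter_add_card_filter_not (s := N) (fun z => #{e ∈ E | z ∈ e} =
    Fintype.card C * f z)
  have h5 : #{z ∈ N | #{e ∈ E | z ∈ e} = Fintype.card C * f z} ≤
      #{z | z ≠ w ∧ s(x, z) ∈ E ∧ #{e ∈ E | z ∈ e} = Fintype.card C * f z} := by
    refine card_le_card fun z hz => ?_
    simp only [N, mem_filter, mem_univ, true_and] at hz ⊢
    tauto
  have h6 := hslack w
  have h7 := hdegE' w (by simp)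
  omega

end Fan

/-! ### Edge counts in forests and unicyclic graphs -/

/-- A forest extends to a spanning tree of the complete graph. -/
theorem card_edgeFinset_lt_of_isAcyclic {W : Type*} [Fintype W] [Nonempty W] {J : SimpleGraph W}
    [Fintype J.edgeSet] (h : J.IsAcyclic) : #J.edgeFinset + 1 ≤ Fintype.card W := by
  classical
  obtain ⟨T, hJT, -, hT⟩ := SimpleGraph.connected_top.exists_isTree_le_of_le_of_isAcyclic
    (le_top : J ≤ ⊤) h
  rw [← hT.card_edgeFinset]
  gcongr

/-- A unicyclic graph becomes acyclic after deletion of a suitable edge. -/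
theorem IsUnicyclic.exists_isAcyclic_deleteEdges {W : Type*} {J : SimpleGraph W}
    (h : IsUnicyclic J) : ∃ e, (J.deleteEdges {e}).IsAcyclic := by
  obtain ⟨-, H, ⟨v, p, hp, rfl⟩, huniq⟩ := h
  obtain ⟨e, he⟩ := List.exists_mem_of_ne_nil p.edges (fun h => by
    have := hp.three_le_length
    rw [← p.length_edges, h] at this
    simp at this)
  -- A cycle surviving the deletion of `e` would be the unique cycle of `J`, which contains `e`.
  refine ⟨e, fun u q hq => ?_⟩
  have hle : J.deleteEdges {e} ≤ J := J.deleteEdges_le _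
  have hq' := huniq _ ⟨u, q.mapLe hle, hq.mapLe hle, rfl⟩
  have h1 : e ∈ (q.mapLe hle).edges := by
    rw [← SimpleGraph.Walk.mem_edges_toSubgraph, hq', SimpleGraph.Walk.mem_edges_toSubgraph]
    exact he
  have h2 : e ∈ q.edges := by simpa using h1
  have h3 := q.edges_subset_edgeSet h2
  rw [SimpleGraph.edgeSet_deleteEdges] at h3
  exact h3.2 rfl

/-- If every component of `H` is acyclic after deletion of some edge, and each vertex of the
finite set `D` has at least two neighbours in `D`, then each has exactly two. -/
theorem card_neighbors_le_two {W : Type*} [Fintype W] [DecidableEq W] {H : SimpleGraph W}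
    [DecidableRel H.Adj]
    (hH : ∀ C : H.ConnectedComponent, ∃ e, (C.toSimpleGraph.deleteEdges {e}).IsAcyclic)
    {D : Finset W} (hD : ∀ d ∈ D, 2 ≤ #{z ∈ D | H.Adj d z}) {d : W} (hd : d ∈ D) :
    #{z ∈ D | H.Adj d z} ≤ 2 := by
  classical
  let C := H.connectedComponentMk d
  obtain ⟨e, he⟩ := hH C
  let S : Set C := {z | (z : W) ∈ D}
  let J : SimpleGraph S := C.toSimpleGraph.induce S
  let J' : SimpleGraph S := (C.toSimpleGraph.deleteEdges {e}).induce S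
  have hJ' : J'.IsAcyclic := he.induce S
  let d₀ : S := ⟨⟨d, rfl⟩, hd⟩
  have : Nonempty S := ⟨d₀⟩
  have hcard := card_edgeFinset_lt_of_isAcyclic hJ'
  have hadj : ∀ u v : S, J.Adj u v ↔ H.Adj (u : C) (v : C) := fun u v => Iff.rfl
  have hdeg : ∀ u : S, J.degree u = #{z ∈ D | H.Adj (u : C) z} := by
    intro u
    rw [← SimpleGraph.card_neighborFinset_eq_degree]
    refine card_bij (fun v _ => ((v : C) : W)) (fun v hv => ?_) (fun v _ v' _ h => ?_)
      (fun z hz => ?_)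
    · exact mem_filter.2 ⟨v.2, (hadj u v).1 ((J.mem_neighborFinset u v).1 hv)⟩
    · exact Subtype.ext (Subtype.ext h)
    · obtain ⟨hzD, hz⟩ := mem_filter.1 hz
      have hzC : z ∈ C.supp := by
        have hu : ((u : C) : W) ∈ C.supp := (u : C).2
        rw [SimpleGraph.ConnectedComponent.mem_supp_iff] at hu ⊢
        rw [← hu]
        exact SimpleGraph.ConnectedComponent.sound hz.symm.reachable
      exact ⟨⟨⟨z, hzC⟩, hzD⟩, (J.mem_neighborFinset _ _).2 hz, rfl⟩
  have hedge : #J.edgeFinset ≤ #J'.edgeFinset + 1 := by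
    have hsub : J.edgeFinset.image (Sym2.map Subtype.val) ⊆
        insert e (J'.edgeFinset.image (Sym2.map Subtype.val)) := by
      intro t ht
      obtain ⟨t', ht', rfl⟩ := mem_image.1 ht
      clear ht
      induction t' with
      | _ u v =>
        rw [SimpleGraph.mem_edgeFinset, SimpleGraph.mem_edgeSet] at ht'
        by_cases hte : s((u : C), (v : C)) = e
        · exact mem_insert.2 (Or.inl hte)
        · refine mem_insert_of_mem (mem_image_of_mem _ ?_)
          rw [SimpleGraph.mem_edgeFinset, SimpleGraph.mem_edgeSet]
          change (C.toSimpleGraph.deleteEdges {e}).Adj u v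
          rw [SimpleGraph.deleteEdges_adj]
          exact ⟨ht', hte⟩
    have hinj : Function.Injective (Sym2.map (Subtype.val : S → C)) :=
      Sym2.map.injective Subtype.val_injective
    have := (card_le_card hsub).trans (card_insert_le _ _)
    rwa [card_image_of_injective _ hinj, card_image_of_injective _ hinj] at this
  have hsum := J.sum_degrees_eq_twice_card_edges
  by_contra! hcon
  -- Being a forest plus at most one edge, `J` has at most as many edges as vertices, hence average
  -- degree at most 2.
  have hlt : ∑ _u : S, 2 < ∑ u : S, J.degree u := by
    refine sum_lt_sum (fun u _ => ?_) ⟨d₀, mem_univ _, ?_⟩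
    · rw [hdeg]
      exact hD _ u.2
    · rw [hdeg]
      exact hcon
  simp only [sum_const, card_univ, smul_eq_mul] at hlt
  omega

/-! ### The lower bound Δ_f and transfer between forms of colouring -/

theorem degree_le_mul_fMaxDegree {V : Type*} [Fintype V] (G : SimpleGraph V) [DecidableRel G.Adj]
    {f : V → ℕ} (hf : ∀ v, 0 < f v) (v : V) : G.degree v ≤ fMaxDegree G f * f v := by
  have h1 : ⌈(G.degree v : ℚ) / (f v : ℚ)⌉₊ ≤ fMaxDegree G f :=
    le_sup (f := fun v => ⌈(G.degree v : ℚ) / (f v : ℚ)⌉₊) (mem_univ v)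
  have h2 := Nat.ceil_le.1 h1
  rw [div_le_iff₀ (by exact_mod_cast hf v)] at h2
  exact_mod_cast h2

theorem FColorable.degree_le {V : Type*} [Fintype V] {G : SimpleGraph V} [DecidableRel G.Adj]
    {f : V → ℕ} {j : ℕ} (h : FColorable G f j) (v : V) : G.degree v ≤ j * f v := by
  classical
  obtain ⟨c, hc⟩ := h
  have h1 : G.degree v = #{e : G.edgeSet | v ∈ (e : Sym2 V)} := by
    rw [← G.card_incidenceFinset_eq_degree, G.incidenceFinset_eq_filter,
      ← card_image_of_injective _ Subtype.val_injective]
    congr 1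
    ext e
    simp [and_comm]
  rw [h1, card_eq_sum_card_fiberwise (f := c) (t := univ) (by intro; simp)]
  refine (sum_le_card_nsmul univ _ (f v) fun i _ => ?_).trans (by simp)
  have := hc v i
  rwa [Nat.card_eq_fintype_card, Fintype.card_subtype, ← filter_filter] at this

theorem FColorable.fMaxDegree_le {V : Type*} [Fintype V] {G : SimpleGraph V} [DecidableRel G.Adj]
    {f : V → ℕ} (hf : ∀ v, 0 < f v) {j : ℕ} (h : FColorable G f j) : fMaxDegree G f ≤ j := by
  refine Finset.sup_le fun v _ => Nat.ceil_le.2 ?_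
  rw [div_le_iff₀ (by exact_mod_cast hf v)]
  exact_mod_cast h.degree_le v

theorem isFClassOne_of_fColorable {V : Type*} [Fintype V] {G : SimpleGraph V} [DecidableRel G.Adj]
    {f : V → ℕ} (hf : ∀ v, 0 < f v) (h : FColorable G f (fMaxDegree G f)) : IsFClassOne G f :=
  le_antisymm (Nat.sInf_le h) ((fColorable_fChromaticIndex G f hf).fMaxDegree_le hf)

theorem IsEdgeColoring.fColorable {V : Type*} [Fintype V] [DecidableEq V] {G : SimpleGraph V}
    [DecidableRel G.Adj] {f : V → ℕ} {k : ℕ} {c : Sym2 V → Fin k}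
    (h : IsEdgeColoring G.edgeFinset f c) : FColorable G f k := by
  classical
  refine ⟨fun e => c e, fun v i => le_trans ?_ (h v i)⟩
  rw [Nat.card_eq_fintype_card, Fintype.card_subtype]
  refine card_le_card_of_injOn Subtype.val (fun e he => ?_) Subtype.val_injective.injOn
  have he := (mem_filter.1 he).2
  exact mem_coe.2 (mem_filter.2 ⟨SimpleGraph.mem_edgeFinset.2 e.2, he⟩)

end FColoring

/-! ### The minimal uncolourable edge set and the f-core -/

open Finset in
theorem mainTheorem2 {V : Type*} [Fintype V] (G : SimpleGraph V) [DecidableRel G.Adj]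
    (f : V → ℕ) (hf : ∀ v, 0 < f v) (hG : G.Connected)
    (hcore : ∀ C : (FColoring.fCore G f).ConnectedComponent,
      C.toSimpleGraph.IsTree ∨ FColoring.IsUnicyclic C.toSimpleGraph)
    (hreg : ¬ ((FColoring.fMaxVertices G f).Nonempty ∧
      (FColoring.fCore G f).IsRegularOfDegree 2)) :
    FColoring.IsFClassOne G f := by
  classical
  refine FColoring.isFClassOne_of_fColorable hf ?_
  have hdegG := FColoring.degree_le_mul_fMaxDegree G hf
  set H := FColoring.fCore G f with hH
  have hmemS : ∀ v, v ∈ FColoring.fMaxVertices G f ↔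
      G.degree v = FColoring.fMaxDegree G f * f v := fun v => by
    rw [mul_comm]; rfl
  generalize hk : FColoring.fMaxDegree G f = k at hdegG hmemS ⊢
  rcases Nat.eq_zero_or_pos k with rfl | hkpos
  · have : IsEmpty G.edgeSet := ⟨fun ⟨e, he⟩ => by
      induction e with
      | _ u v =>
        have h1 := (G.degree_pos_iff_exists_adj u).2 ⟨v, he⟩
        have h2 := hdegG u
        omega⟩
    exact ⟨isEmptyElim, fun v i => i.elim0⟩
  have : NeZero k := ⟨hkpos.ne'⟩
  by_contra hno
  have hno' : ¬ ∃ c : Sym2 V → Fin k, FColoring.IsEdgeColoring G.edgeFinset f c :=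
    fun ⟨c, hc⟩ => hno hc.fColorable
  obtain ⟨E, hEG, hE⟩ := exists_minimal_le_of_wellFoundedLT
    (fun E : Finset (Sym2 V) => ¬ ∃ c : Sym2 V → Fin k, FColoring.IsEdgeColoring E f c) _ hno'
  have hadj : ∀ u v, s(u, v) ∈ E → G.Adj u v := fun u v h => SimpleGraph.mem_edgeFinset.1 (hEG h)
  have hGE : ∀ v, G.degree v = #{e ∈ G.edgeFinset | v ∈ e} := fun v => by
    rw [← G.card_incidenceFinset_eq_degree, G.incidenceFinset_eq_filter]
  have hdE : ∀ v, #{e ∈ E | v ∈ e} ≤ G.degree v := fun v =>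
    (card_le_card (filter_subset_filter _ hEG)).trans (hGE v).ge
  let M : Finset V := {v | #{e ∈ E | v ∈ e} = k * f v}
  have hval : ∀ x w, s(x, w) ∈ E → k * f w + 1 ≤ #{e ∈ E | w ∈ e} +
      #{z ∈ M | z ≠ w ∧ s(x, z) ∈ E} := by
    intro x w hxw
    obtain ⟨c, hc⟩ : ∃ c : Sym2 V → Fin k, FColoring.IsEdgeColoring (E.erase s(x, w)) f c := by
      by_contra h
      exact notMem_erase _ _ (hE.2 h (erase_subset _ _) hxw)
    have := FColoring.adjacency_lemma hf (fun v => by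
      rw [Fintype.card_fin]; exact (hdE v).trans (hdegG v)) hxw hc hE.1
    rw [Fintype.card_fin] at this
    convert this using 3
    ext z
    simp only [M, mem_filter, mem_univ, true_and]
    tauto
  have hone : ∀ x w, s(x, w) ∈ E → ∃ m ∈ M, m ≠ w ∧ s(x, m) ∈ E := by
    intro x w hxw
    have h1 := hval x w hxw
    have h2 := (hdE w).trans (hdegG w)
    obtain ⟨m, hm⟩ := card_pos.1 (show 0 < #{z ∈ M | z ≠ w ∧ s(x, z) ∈ E} by omega)
    exact ⟨m, mem_filter.1 hm⟩
  have htwo : ∀ x w, s(x, w) ∈ E → ∃ m₁ ∈ M, ∃ m₂ ∈ M, m₁ ≠ m₂ ∧ s(x, m₁) ∈ E ∧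
      s(x, m₂) ∈ E := by
    intro x w hxw
    obtain ⟨m₁, h1, -, h1'⟩ := hone x w hxw
    -- Applying the adjacency lemma again, to the edge `x m₁`, yields a different second neighbour.
    obtain ⟨m₂, h2, hne, h2'⟩ := hone x m₁ h1'
    exact ⟨m₁, h1, m₂, h2, hne.symm, h1', h2'⟩
  have hMS : ∀ v ∈ M, v ∈ FColoring.fMaxVertices G f := by
    intro v hv
    have h1 := (mem_filter.1 hv).2
    have h2 := hdE v
    have h3 := hdegG v
    exact (hmemS v).2 (by omega)
  have hacyc : ∀ C : H.ConnectedComponent, ∃ e, (C.toSimpleGraph.deleteEdges {e}).IsAcyclic := by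
    intro C
    rcases hcore C with h | h
    · obtain ⟨v⟩ := h.1.nonempty
      -- Deleting a loop removes nothing, so trees fit the same form as unicyclic graphs.
      exact ⟨s(v, v), h.2.anti (SimpleGraph.deleteEdges_le _)⟩
    · exact h.exists_isAcyclic_deleteEdges
  let D : Finset (FColoring.fMaxVertices G f) := {v | (v : V) ∈ M}
  have htwoD : ∀ (x : FColoring.fMaxVertices G f) (w : V), s((x : V), w) ∈ E →
      2 ≤ #{z ∈ D | H.Adj x z} := by
    intro x w hxw
    obtain ⟨m₁, h1, m₂, h2, hne, h1', h2'⟩ := htwo x w hxw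
    refine one_lt_card.2 ⟨⟨m₁, hMS _ h1⟩, ?_, ⟨m₂, hMS _ h2⟩, ?_, by simpa using hne⟩
    · exact mem_filter.2 ⟨mem_filter.2 ⟨mem_univ _, h1⟩, hadj _ _ h1'⟩
    · exact mem_filter.2 ⟨mem_filter.2 ⟨mem_univ _, h2⟩, hadj _ _ h2'⟩
  have htouchM : ∀ v ∈ M, ∃ w, s(v, w) ∈ E := by
    intro v hv
    have h1 := (mem_filter.1 hv).2
    obtain ⟨e, he⟩ := card_pos.1 (show 0 < #{e ∈ E | v ∈ e} by
      rw [h1]; exact Nat.mul_pos hkpos (hf v))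
    obtain ⟨he, hve⟩ := mem_filter.1 he
    obtain ⟨w, rfl⟩ := Sym2.mem_iff_exists.1 hve
    exact ⟨w, he⟩
  have hD2 : ∀ d ∈ D, 2 ≤ #{z ∈ D | H.Adj d z} := by
    intro d hd
    obtain ⟨w, hw⟩ := htouchM d (mem_filter.1 hd).2
    exact htwoD d w hw
  have hDle : ∀ d ∈ D, #{z ∈ D | H.Adj d z} ≤ 2 := fun d hd =>
    FColoring.card_neighbors_le_two hacyc hD2 hd
  -- vertices touched by `E` have almost maximum degree in `E`
  have hnear : ∀ w z, s(w, z) ∈ E → k * f w ≤ #{e ∈ E | w ∈ e} + 1 := by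
    intro w z hwz
    obtain ⟨m, hm, -, hwm⟩ := hone w z hwz
    rw [Sym2.eq_swap] at hwm
    have h1 := hval m w hwm
    have hmD : (⟨m, hMS m hm⟩ : FColoring.fMaxVertices G f) ∈ D :=
      mem_filter.2 ⟨mem_univ _, hm⟩
    have h2 := hDle _ hmD
    have h3 : #{z ∈ M | z ≠ w ∧ s(m, z) ∈ E} ≤
        #(({z ∈ D | H.Adj ⟨m, hMS m hm⟩ z} : Finset _).image Subtype.val) := by
      refine card_le_card fun z hz => ?_
      obtain ⟨hzM, -, hz⟩ := mem_filter.1 hz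
      exact mem_image.2 ⟨⟨z, hMS z hzM⟩,
        mem_filter.2 ⟨mem_filter.2 ⟨mem_univ _, hzM⟩, hadj _ _ hz⟩, rfl⟩
    have h4 := h3.trans card_image_le
    omega
  obtain ⟨e₀, he₀⟩ : E.Nonempty := by
    rw [nonempty_iff_ne_empty]
    rintro rfl
    exact hE.1 ⟨fun _ => 0, fun v i => by simp [FColoring.colorCount]⟩
  -- If no touched vertex had an edge outside `E`, connectivity would spread `E` over all of G, and
  -- the core would be 2-regular.
  obtain ⟨v, z, hvz, y, hy, hyE⟩ : ∃ v z, s(v, z) ∈ E ∧ ∃ y, G.Adj v y ∧ s(v, y) ∉ E := by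
    by_contra! hcon
    have htouch : ∀ u, ∃ z, s(u, z) ∈ E := by
      intro u
      induction e₀ with
      | _ a b =>
        have hr := (SimpleGraph.reachable_iff_reflTransGen a u).1 (hG.preconnected a u)
        induction hr with
        | refl => exact ⟨b, he₀⟩
        | tail _ hst ih =>
          obtain ⟨z, hz⟩ := ih
          exact ⟨_, by rw [Sym2.eq_swap]; exact hcon _ z hz _ hst⟩
    have hEall : ∀ u v, G.Adj u v → s(u, v) ∈ E := fun u v h => by
      obtain ⟨z, hz⟩ := htouch u
      exact hcon u z hz v h
    have hEeq : E = G.edgeFinset := by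
      refine subset_antisymm hEG fun e he => ?_
      induction e with
      | _ a b => exact hEall a b (SimpleGraph.mem_edgeFinset.1 he)
    have hDuniv : ∀ x, x ∈ D := fun x => by
      refine mem_filter.2 ⟨mem_univ _, mem_filter.2 ⟨mem_univ _, ?_⟩⟩
      rw [hEeq, ← hGE]
      exact (hmemS x).1 x.2
    apply hreg
    constructor
    · induction e₀ with
      | _ a b =>
        obtain ⟨m, hm, -⟩ := hone a b he₀
        exact ⟨m, hMS m hm⟩
    · intro x
      rw [← SimpleGraph.card_neighborFinset_eq_degree]
      refine le_antisymm ((card_le_card fun z hz => ?_).trans (hDle x (hDuniv x)))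
        ((hD2 x (hDuniv x)).trans (card_le_card fun z hz => ?_))
      · exact mem_filter.2 ⟨hDuniv z, (SimpleGraph.mem_neighborFinset _ _ _).1 hz⟩
      · exact (SimpleGraph.mem_neighborFinset _ _ _).2 (mem_filter.1 hz).2
  have hlt : #{e ∈ E | v ∈ e} < G.degree v := by
    rw [hGE]
    refine card_lt_card ⟨filter_subset_filter _ hEG, fun h => hyE ?_⟩
    exact (mem_filter.1 (h (mem_filter.2 ⟨SimpleGraph.mem_edgeFinset.2 hy, by simp⟩))).1
  have h1 := hnear v z hvz
  have h2 := hdegG v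
  -- The inequalities k f(v) - 1 ≤ d_E(v) < d_G(v) ≤ k f(v) force d_G(v) = k f(v).
  have hvS : v ∈ FColoring.fMaxVertices G f := (hmemS v).2 (by omega)
  let v' : FColoring.fMaxVertices G f := ⟨v, hvS⟩
  have hvD : v' ∉ D := by
    intro h
    have : #{e ∈ E | v ∈ e} = k * f v := (mem_filter.1 (mem_filter.1 h).2).2
    omega
  have hmono : ∀ x, #{z ∈ D | H.Adj x z} ≤ #{z ∈ insert v' D | H.Adj x z} := fun x =>
    card_le_card (filter_subset_filter _ (subset_insert _ _))
  have hD' : ∀ d ∈ insert v' D, 2 ≤ #{z ∈ insert v' D | H.Adj d z} := by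
    intro d hd
    refine le_trans ?_ (hmono d)
    rcases mem_insert.1 hd with rfl | hd
    · exact htwoD v' z hvz
    · exact hD2 d hd
  obtain ⟨m, hm, -, hvm⟩ := hone v z hvz
  let m' : FColoring.fMaxVertices G f := ⟨m, hMS m hm⟩
  have hmD : m' ∈ D := mem_filter.2 ⟨mem_univ _, hm⟩
  -- `m'` has two neighbours in `D` and also `v'`, against the bound 2 for the enlarged set.
  have h3 := FColoring.card_neighbors_le_two hacyc hD' (mem_insert_of_mem hmD)
  have hmv : H.Adj m' v' := (hadj _ _ hvm).symm
  rw [filter_insert, if_pos hmv, card_insert_of_notMem (fun h => hvD (mem_filter.1 h).1)] at h3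
  have := hD2 m' hmD
  omega
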